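/- Let $n\ge 0$ be an integer, $N=\{0,1\}^n$, let $S$ (seeds) and $M$ (outputs) be finite non-empty sets, and let $\mathrm{Ext}=\{f_s\}_{s\in S}$ be a family of functions $f_s:N\to M$. (Strong extractors are the case $M=S\times M'$, $f_s(x)=(s,f_s'(x))$.) Let $F_s$ be the $M\times N$ matrix with $(F_s)_{y,x}=1$ if $f_s(x)=y$ and $0$ otherwise, let $\upsilon_M$ be the uniform distribution on $M$, and put $$\Delta[\mathrm{Ext}](P)=\frac1{|S|}\sum_{s\in S}F_sP-\Big(\sum_{x\in N}P(x)\Big)\upsilon_M .$$ Let $k,\varepsilon\in\mathbb R$; logarithms are to base $2$. *Norms.* For $P$ in $\mathbb R^N$ or $\mathbb C^N$ let $\|P\|_{\cap\{2^k\ell_\infty,\ell_1\}}=\max\{2^k\|P\|_{\ell_\infty},\|P\|_{\ell_1}\}$, and let $\|\Delta[\mathrm{Ext}]:\cap\{2^k\ell_\infty,\ell_1\}\to\ell_1\|$ be the supremum of $\|\Delta[\mathrm{Ext}](P)\|_{\ell_1}$ over all $P$ with $\|P\|_{\cap\{2^k\ell_\infty,\ell_1\}}\le1$. For $Q\in\mathbb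 N$ regard $x\in \mathrm{Mat}_Q(\mathbb C^N)$ as a matrix on $\mathbb C^Q\otimes\mathbb C^N$ that is diagonal in the second factor, and put $$\|x\|_{M_Q(\cap\cdot\cap\{2^k\ell_\infty,\ell_1\})}=\inf_{x=ab^*}\max\{2^{k/2}\|a\|_\infty,\|\Gamma(a)\|_\infty\}\cdot\max\{2^{k/2}\|b\|_\infty,\|\Gamma(b)\|_\infty\},$$ where $a,b$ run over all matrices on $\mathbb C^Q\otimes\mathbb C^N$, $\|\cdot\|_\infty$ is the operator norm, and $\Gamma$ is linear with $\Gamma(|i\rangle\langle j|\otimes|k\rangle\langle l|)=|i\rangle\langle j|\otimes\langle k|\otimes\langle l|$. Similarly, for $z\in\mathrm{Mat}_Q(\mathbb C^M)$ let $\|z\|_{M_Q(\ell_1)}=\sup\|(A\otimes 1)z(B\otimes1)\|_1$, the supremum being over $A,B\in\mathrm{Mat}_Q$ with Hilbert–Schmidt norm at most $1$, and $\|\cdot\|_1$ the trace norm. Let $\|\Delta[\mathrm{Ext}]:\cap\cdot\cap\{2^k\ell_\infty,\ell_1\}\to\ell_1\|_{\mathrm{cb}}$ be the supremum over $Q\in\mathbb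 N$ of the norms of the entrywise maps $\mathrm{id}_{\mathrm{Mat}_Q}\otimes\Delta[\mathrm{Ext}]$ with respect to these norms. *Extractors.* $\mathrm{Ext}$ is a $(k,\varepsilon)$-extractor if $\|\frac1{|S|}\sum_sF_sP-\upsilon_M\|_{\ell_1}\le\varepsilon$ for every probability distribution $P$ on $N$ with $H_{\min}(P)=-\log\|P\|_{\ell_\infty}\ge k$. It is a quantum-proof $(k,\varepsilon)$-extractor if, for every $Q\in\mathbb N$ and every density matrix $\rho_{QN}=\sum_x\rho_x\otimes|x\rangle\langle x|$ with $\rho_x\in \mathrm{Mat}_Q$ positive semidefinite and $H_{\min}(N|Q)_\rho\ge k$, $$\Big\|\frac1{|S|}\sum_s(\mathrm{id}_Q\otimes F_s)(\rho_{QN})-\rho_Q\otimes\upsilon_M\Big\|_1\le\varepsilon ,$$ where $\rho_Q=\sum_x\rho_x$ and $H_{\min}(N|Q)_\rho=-\log\min\{t:\rho_{QN}\le t\,\sigma_Q\otimes 1_N\text{ for some density matrix }\sigma_Q\}$. Let $K_G$ be the (real) Grothendieck constant, i.e. the least $K$ such that, for every real matrix $(A_{ij})$, $\sum_{ij}A_{ij}\,\vec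 a_i\cdot\vec b_j\le K\max\{\sum_{ij}A_{ij}a_ib_j:a_i,b_j\in\mathbb{R},\ |a_i|,|b_j|\le1\}$ for all vectors $\vec a_i,\vec b_j$ of Euclidean norm at most $1$ in any $\mathbb R^d$. Then: 1. If $k\le n$ and $\|\Delta[\mathrm{Ext}]:\cap\{2^k\ell_\infty,\ell_1\}\to\ell_1\|\le\varepsilon$ (with real or with complex $P$), then $\|\Delta[\mathrm{Ext}]:\cap\cdot\cap\{2^k\ell_\infty,\ell_1\}\to\ell_1\|_{\mathrm{cb}}\le K_G\,2^{n-k}\varepsilon$. 2. If $\mathrm{Ext}$ is a $(k,\varepsilon)$-extractor, then it is a quantum-proof $(k+1,\,6K_G2^{n-k}\varepsilon)$-extractor. 3. In particular, if $n\ge1$, $k\ge n-\log n$ and $\mathrm{Ext}$ is a $(k,\varepsilon)$-extractor, then it is a quantum-proof $(k+1,\,6K_G\,n\,\varepsilon)$-extractor. -/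

import Mathlib

noncomputable section

namespace QExt

open scoped ENNReal Kronecker ComplexOrder MatrixOrder Matrix.Norms.L2Operator

/-! ### The Grothendieck constant -/

/-- `K` is an admissible constant in Grothendieck's inequality for real matrices: whenever the
bilinear form of `A` is bounded by `c` on scalars of modulus at most one, it is bounded by `K * c`
on vectors of Euclidean norm at most one (in any dimension). -/
def IsGrothendieckBound (K : ℝ) : Prop :=
  ∀ (p q : ℕ) (A : Matrix (Fin p) (Fin q) ℝ) (c : ℝ),
    (∀ (a : Fin p → ℝ) (b : Fin q → ℝ), (∀ i, |a i| ≤ 1) → (∀ j, |b j| ≤ 1) →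
      ∑ i, ∑ j, A i j * (a i * b j) ≤ c) →
    ∀ (d : ℕ) (a : Fin p → EuclideanSpace ℝ (Fin d)) (b : Fin q → EuclideanSpace ℝ (Fin d)),
      (∀ i, ‖a i‖ ≤ 1) → (∀ j, ‖b j‖ ≤ 1) →
      ∑ i, ∑ j, A i j * inner ℝ (a i) (b j) ≤ K * c

/-- The (real) Grothendieck constant: the least admissible constant. -/
def grothendieckConstant : ℝ := sInf {K : ℝ | IsGrothendieckBound K}

/-! ### Families of functions and the associated linear maps -/

section Classical

variable {X Y S : Type*} [Fintype X] [Fintype Y] [Fintype S] [DecidableEq Y]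

/-- The `0`-`1` matrix of a function `g : X → Y`; it sends the distribution of a random variable
`x` to the distribution of `g x`. -/
def funMatrix (𝕜 : Type*) [RCLike 𝕜] (g : X → Y) : Matrix Y X 𝕜 :=
  Matrix.of fun y x => if g x = y then 1 else 0

/-- The uniform distribution. -/
def uniform (𝕜 : Type*) [RCLike 𝕜] (Y : Type*) [Fintype Y] : Y → 𝕜 :=
  fun _ => (Fintype.card Y : 𝕜)⁻¹

/-- The linear map `P ↦ |S|⁻¹ ∑ₛ Fₛ P - (∑ₓ P x) • uniform`. -/
def extMap (𝕜 : Type*) [RCLike 𝕜] (f : S → X → Y) : (X → 𝕜) →ₗ[𝕜] (Y → 𝕜) :=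
  (Fintype.card S : 𝕜)⁻¹ • ∑ s, (funMatrix 𝕜 (f s)).mulVecLin
    - (LinearMap.toSpanSingleton 𝕜 (Y → 𝕜) (uniform 𝕜 Y)).comp (∑ x, LinearMap.proj x)

/-- The min-entropy (in bits) of a distribution; `‖P‖` is the sup norm. -/
def minEntropy (P : X → ℝ) : ℝ := -Real.logb 2 ‖P‖

/-- `f = (fₛ)ₛ` is a `(k, ε)`-extractor. -/
def IsExtractor (f : S → X → Y) (k ε : ℝ) : Prop :=
  ∀ P ∈ stdSimplex ℝ X, k ≤ minEntropy P →
    ∑ y, |((Fintype.card S : ℝ)⁻¹ • ∑ s, (funMatrix ℝ (f s)).mulVec P) y - uniform ℝ Y y| ≤ ε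

end Classical

/-! ### Bounded and completely bounded norms -/

/-- The norm `sup {β (u x) : α x ≤ 1}` of a map `u` with respect to norms `α` and `β`. -/
def boundedNorm {E F : Type*} (α : E → ℝ≥0∞) (β : F → ℝ≥0∞) (u : E → F) : ℝ≥0∞ :=
  ⨆ (x : E) (_ : α x ≤ 1), β (u x)

/-- The completely bounded norm of a linear map `u`, with respect to sequences of norms on the
matrix spaces `Mat_Q(E)` and `Mat_Q(F)`: the supremum over `Q` of the norms of the entrywise
amplifications of `u`. -/
def cbNorm {E F : Type*} [AddCommGroup E] [Module ℂ E] [AddCommGroup F] [Module ℂ F]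
    (α : ∀ Q : ℕ, Matrix (Fin Q) (Fin Q) E → ℝ≥0∞)
    (β : ∀ Q : ℕ, Matrix (Fin Q) (Fin Q) F → ℝ≥0∞) (u : E →ₗ[ℂ] F) : ℝ≥0∞ :=
  ⨆ Q : ℕ, boundedNorm (α Q) (β Q) fun x => x.map u

/-- The `ℓ₁` norm. -/
def l1Norm {𝕜 : Type*} [RCLike 𝕜] {Y : Type*} [Fintype Y] (v : Y → 𝕜) : ℝ≥0∞ :=
  ENNReal.ofReal (∑ y, ‖v y‖)

/-- The norm `∩{K ℓ_∞, ℓ₁}`. -/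
def capNorm {𝕜 : Type*} [RCLike 𝕜] {X : Type*} [Fintype X] (K : ℝ) (P : X → 𝕜) : ℝ≥0∞ :=
  ENNReal.ofReal (max (K * ‖P‖) (∑ x, ‖P x‖))

/-! ### Matrix norms; `‖·‖` on matrices is the operator norm -/

section Quantum

variable {ι q : Type*} [Fintype ι] [DecidableEq ι] [Fintype q] [DecidableEq q]

/-- The trace norm `Tr √(A* A)`. -/
def traceNorm (A : Matrix ι ι ℂ) : ℝ :=
  (CFC.sqrt (A.conjTranspose * A)).trace.re

/-- The Hilbert-Schmidt norm `√Tr(A* A)`. -/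
def hsNorm (A : Matrix ι ι ℂ) : ℝ :=
  √(A.conjTranspose * A).trace.re

/-- The map `|i⟩⟨j| ⊗ |k⟩⟨l| ↦ |i⟩⟨j| ⊗ ⟨k| ⊗ ⟨l|`. -/
def gammaMap (a : Matrix (q × ι) (q × ι) ℂ) : Matrix q (q × ι × ι) ℂ :=
  Matrix.of fun i jkl => a (i, jkl.2.1) (jkl.1, jkl.2.2)

/-- The norm `∩·∩{K M_N, S¹_N}` on `Mat_Q(Mat_N)`. -/
def capCapMatrixNorm (K : ℝ) (x : Matrix (q × ι) (q × ι) ℂ) : ℝ≥0∞ :=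
  ⨅ (a : Matrix (q × ι) (q × ι) ℂ) (b : Matrix (q × ι) (q × ι) ℂ)
    (_ : x = a * b.conjTranspose),
    ENNReal.ofReal (max (√K * ‖a‖) ‖gammaMap a‖ * max (√K * ‖b‖) ‖gammaMap b‖)

/-- The norm `(∞;1)` on `Mat_Q(Mat_N)`, i.e. the norm of `Mat_Q(S¹_N)`. -/
def inftyOneNorm (x : Matrix (q × ι) (q × ι) ℂ) : ℝ≥0∞ :=
  ⨆ (A : Matrix q q ℂ) (B : Matrix q q ℂ) (_ : hsNorm A ≤ 1) (_ : hsNorm B ≤ 1),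
    ENNReal.ofReal (traceNorm ((A ⊗ₖ (1 : Matrix ι ι ℂ)) * x * (B ⊗ₖ (1 : Matrix ι ι ℂ))))

/-- The embedding of `Mat_Q(ℂ^N)` in `Mat_Q(Mat_N)`, with `ℂ^N` the diagonal matrices. -/
def diagEmbed (x : Matrix q q (ι → ℂ)) : Matrix (q × ι) (q × ι) ℂ :=
  Matrix.blockDiagonal fun k => x.map fun v => v k

/-- The sequence of norms of the operator space `∩·∩{K ℓ_∞, ℓ₁}`. -/
def capCapNorm (K : ℝ) (Q : ℕ) (x : Matrix (Fin Q) (Fin Q) (ι → ℂ)) : ℝ≥0∞ :=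
  capCapMatrixNorm K (diagEmbed x)

/-- The sequence of norms of the operator space `ℓ₁`. -/
def l1MatrixNorm (Q : ℕ) (x : Matrix (Fin Q) (Fin Q) (ι → ℂ)) : ℝ≥0∞ :=
  inftyOneNorm (diagEmbed x)

/-- The conditional min-entropy (in bits) `H_min(N|Q)_ρ` of a state `ρ` on `Q ⊗ N`: minus the
logarithm of the least `t` such that `ρ ≤ t • σ ⊗ 1` for some state `σ` on `Q`. -/
def condMinEntropy (ρ : Matrix (q × ι) (q × ι) ℂ) : ℝ :=
  -Real.logb 2 (sInf {t : ℝ | ∃ σ : Matrix q q ℂ, σ.PosSemidef ∧ σ.trace = 1 ∧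
    (((t : ℂ) • (σ ⊗ₖ (1 : Matrix ι ι ℂ))) - ρ).PosSemidef})

end Quantum

/-- `f = (fₛ)ₛ` is a quantum-proof `(k, ε)`-extractor. The state `∑ₓ ρₓ ⊗ |x⟩⟨x|` is
`Matrix.blockDiagonal ρ`, its image under `id ⊗ Fₛ` is `∑ₓ ρₓ ⊗ |fₛ x⟩⟨fₛ x|`, and its marginal
on `Q` is `∑ₓ ρₓ`. -/
def IsQuantumProofExtractor {X Y S : Type*} [Fintype X] [Fintype Y] [Fintype S] [DecidableEq X]
    [DecidableEq Y] (f : S → X → Y) (k ε : ℝ) : Prop :=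
  ∀ (Q : ℕ) (ρ : X → Matrix (Fin Q) (Fin Q) ℂ),
    (∀ x, (ρ x).PosSemidef) → ∑ x, (ρ x).trace = 1 →
    k ≤ condMinEntropy (Matrix.blockDiagonal ρ) →
    traceNorm ((Fintype.card S : ℂ)⁻¹ •
        ∑ s, Matrix.blockDiagonal (fun y => ∑ x, funMatrix ℂ (f s) y x • ρ x)
      - (∑ x, ρ x) ⊗ₖ Matrix.diagonal (uniform ℂ Y)) ≤ ε

end QExt

end

/-!
For a matrix `D` let `c` bound its norm from `ℓ_∞` to `ℓ₁`, and dualise the trace norm of the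
operator with blocks `A (∑ₓ D y x Cₓ) B` by a contraction with diagonal blocks `W_y`. The outcome
is the sum of the `D y x ⟨(W_y A)*, Cₓ B⟩`, a bilinear form in vectors of the Hilbert-Schmidt
space, so Grothendieck's inequality bounds it by `K_G c` if `A`, `B` have Hilbert-Schmidt norm at
most one and the `Cₓ` are contractions. Completely bounded norms are of this shape as they stand.
Quantum side information becomes so on writing `ρₓ = √σ Cₓ √σ`, where `ρₓ ≤ t σ` says that
`‖Cₓ‖ ≤ t`. For an extractor, `c = 3 |X| ε` is found by writing `b = 2 p - 1` and
applying the extractor property to the weights `p` and `1`.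

That `K_G` is finite is seen by representing vectors as Rademacher sums: after truncation they
are bounded functions, and by a fourth moment estimate the remainders are short vectors, whose
contribution is at most half of the bound one wants to prove.
-/

noncomputable section

namespace QExt

open scoped NNReal ENNReal Kronecker ComplexOrder MatrixOrder Matrix.Norms.L2Operator BigOperators

/-! ### Bilinear forms on scalars and on vectors -/

section BilinearForms

variable {I J : Type*} [Fintype I] [Fintype J] {A : Matrix I J ℝ} {c : ℝ}

/-- The norm of the real matrix `A`, as a map from `ℓ_∞` to `ℓ₁`, is at most `c`. -/
def IsBilinBound (A : Matrix I J ℝ) (c : ℝ) : Prop :=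
  ∀ (a : I → ℝ) (b : J → ℝ), (∀ i, |a i| ≤ 1) → (∀ j, |b j| ≤ 1) →
    ∑ i, ∑ j, A i j * (a i * b j) ≤ c

/-- The bilinear form of the real matrix `A` is at most `c` on families of vectors of Euclidean
norm at most one; Grothendieck's inequality compares this to `IsBilinBound`. -/
def IsVectorBilinBound (A : Matrix I J ℝ) (c : ℝ) : Prop :=
  ∀ (d : ℕ) (a : I → EuclideanSpace ℝ (Fin d)) (b : J → EuclideanSpace ℝ (Fin d)),
    (∀ i, ‖a i‖ ≤ 1) → (∀ j, ‖b j‖ ≤ 1) → ∑ i, ∑ j, A i j * inner ℝ (a i) (b j) ≤ c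

lemma isBilinBound_of_sum_abs_mulVec_le
    (h : ∀ b : J → ℝ, (∀ j, |b j| ≤ 1) → ∑ i, |(A.mulVec b) i| ≤ c) : IsBilinBound A c := by
  intro a b ha hb
  refine (Finset.sum_le_sum fun i _ => ?_).trans (h b hb)
  calc ∑ j, A i j * (a i * b j) = a i * A.mulVec b i := by
        simp only [Matrix.mulVec, dotProduct, Finset.mul_sum, mul_left_comm]
    _ ≤ |a i| * |A.mulVec b i| := (le_abs_self _).trans (abs_mul _ _).le
    _ ≤ |A.mulVec b i| := mul_le_of_le_one_left (abs_nonneg _) (ha i)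

lemma IsBilinBound.sum_mul_le (h : IsBilinBound A c) {r s : ℝ} (hr : 0 < r) (hs : 0 < s)
    {a : I → ℝ} {b : J → ℝ} (ha : ∀ i, |a i| ≤ r) (hb : ∀ j, |b j| ≤ s) :
    ∑ i, ∑ j, A i j * (a i * b j) ≤ r * s * c := by
  have hscaled := h (fun i => a i / r) (fun j => b j / s)
    (fun i => by rw [abs_div, abs_of_pos hr]; exact (div_le_one hr).2 (ha i))
    (fun j => by rw [abs_div, abs_of_pos hs]; exact (div_le_one hs).2 (hb j))
  calc ∑ i, ∑ j, A i j * (a i * b j) = r * s * ∑ i, ∑ j, A i j * (a i / r * (b j / s)) := by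
        simp only [Finset.mul_sum]
        refine Finset.sum_congr rfl fun i _ => Finset.sum_congr rfl fun j _ => ?_
        field_simp
    _ ≤ r * s * c := by gcongr

lemma IsVectorBilinBound.nonneg (h : IsVectorBilinBound A c) : 0 ≤ c := by
  simpa using h 0 0 0 (by simp) (by simp)

lemma isVectorBilinBound_sum_abs (A : Matrix I J ℝ) :
    IsVectorBilinBound A (∑ i, ∑ j, |A i j|) := by
  intro d a b ha hb
  gcongr with i _ j _
  have hinner : |inner ℝ (a i) (b j)| ≤ 1 :=
    (abs_real_inner_le_norm _ _).trans (mul_le_one₀ (ha i) (norm_nonneg _) (hb j))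
  calc A i j * inner ℝ (a i) (b j) ≤ |A i j| * |inner ℝ (a i) (b j)| :=
        (le_abs_self _).trans (abs_mul _ _).le
    _ ≤ |A i j| := mul_le_of_le_one_right (abs_nonneg _) hinner

section InnerProductSpace

variable {E : Type*} [NormedAddCommGroup E] [InnerProductSpace ℝ E]

lemma IsVectorBilinBound.sum_mul_inner_le_of_norm_le_one (h : IsVectorBilinBound A c) {a : I → E}
    {b : J → E} (ha : ∀ i, ‖a i‖ ≤ 1) (hb : ∀ j, ‖b j‖ ≤ 1) :
    ∑ i, ∑ j, A i j * inner ℝ (a i) (b j) ≤ c := by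
  let V := Submodule.span ℝ (Set.range a ∪ Set.range b)
  have : FiniteDimensional ℝ V :=
    .span_of_finite ℝ ((Set.finite_range a).union (Set.finite_range b))
  let a' (i : I) : V := ⟨a i, Submodule.subset_span (.inl ⟨i, rfl⟩)⟩
  let b' (j : J) : V := ⟨b j, Submodule.subset_span (.inr ⟨j, rfl⟩)⟩
  let e := (stdOrthonormalBasis ℝ V).repr
  have hle := h _ (fun i => e (a' i)) (fun j => e (b' j))
    (fun i => (e.norm_map _).trans_le (ha i)) (fun j => (e.norm_map _).trans_le (hb j))
  simpa only [e.inner_map_map, Submodule.coe_inner] using hle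

lemma IsVectorBilinBound.sum_mul_inner_le (h : IsVectorBilinBound A c) {r s : ℝ} (hr : 0 < r)
    (hs : 0 < s) {a : I → E} {b : J → E} (ha : ∀ i, ‖a i‖ ≤ r) (hb : ∀ j, ‖b j‖ ≤ s) :
    ∑ i, ∑ j, A i j * inner ℝ (a i) (b j) ≤ r * s * c := by
  have hunit {t : ℝ} (ht : 0 < t) {x : E} (hx : ‖x‖ ≤ t) : ‖t⁻¹ • x‖ ≤ 1 := by
    rw [norm_smul, Real.norm_of_nonneg (inv_nonneg.2 ht.le)]
    exact inv_mul_le_one_of_le₀ hx ht.le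
  have hscaled := h.sum_mul_inner_le_of_norm_le_one (fun i => hunit hr (ha i))
    (fun j => hunit hs (hb j))
  calc ∑ i, ∑ j, A i j * inner ℝ (a i) (b j)
      = r * s * ∑ i, ∑ j, A i j * inner ℝ (r⁻¹ • a i) (s⁻¹ • b j) := by
        simp only [Finset.mul_sum, real_inner_smul_left, real_inner_smul_right]
        refine Finset.sum_congr rfl fun i _ => Finset.sum_congr rfl fun j _ => ?_
        field_simp
    _ ≤ r * s * c := by gcongr

end InnerProductSpace

lemma IsVectorBilinBound.sum_mul_expect_le {Ω : Type*} [Fintype Ω] [Nonempty Ω]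
    (h : IsVectorBilinBound A c) {r s : ℝ} (hr : 0 < r) (hs : 0 < s) {f : I → Ω → ℝ}
    {g : J → Ω → ℝ} (hf : ∀ i, 𝔼 ω, f i ω ^ 2 ≤ r ^ 2) (hg : ∀ j, 𝔼 ω, g j ω ^ 2 ≤ s ^ 2) :
    ∑ i, ∑ j, A i j * 𝔼 ω, f i ω * g j ω ≤ r * s * c := by
  have hcard : (0 : ℝ) < Fintype.card Ω := by exact_mod_cast Fintype.card_pos
  have hnorm {t : ℝ} (ht : 0 < t) {x : Ω → ℝ} (hx : 𝔼 ω, x ω ^ 2 ≤ t ^ 2) :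
      ‖WithLp.toLp 2 x‖ ≤ √(Fintype.card Ω) * t := by
    rw [Fintype.expect_eq_sum_div_card, div_le_iff₀' hcard] at hx
    refine abs_le_of_sq_le_sq' ?_ (by positivity) |>.2
    rw [EuclideanSpace.real_norm_sq_eq, mul_pow, Real.sq_sqrt hcard.le]
    exact hx
  have hle := h.sum_mul_inner_le (mul_pos (Real.sqrt_pos.2 hcard) hr)
    (mul_pos (Real.sqrt_pos.2 hcard) hs) (fun i => hnorm hr (hf i)) (fun j => hnorm hs (hg j))
  rw [← mul_le_mul_iff_right₀ hcard]
  calc Fintype.card Ω * ∑ i, ∑ j, A i j * 𝔼 ω, f i ω * g j ω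
      = ∑ i, ∑ j, A i j * inner ℝ (WithLp.toLp 2 (f i)) (WithLp.toLp 2 (g j)) := by
        simp only [Finset.mul_sum, PiLp.inner_apply, RCLike.inner_apply, conj_trivial,
          Fintype.expect_eq_sum_div_card]
        refine Finset.sum_congr rfl fun i _ => Finset.sum_congr rfl fun j _ => ?_
        rw [mul_left_comm, mul_div_cancel₀ _ hcard.ne', Finset.mul_sum]
        simp only [mul_comm]
    _ ≤ √(Fintype.card Ω) * r * (√(Fintype.card Ω) * s) * c := hle
    _ = Fintype.card Ω * (r * s * c) := by
        rw [mul_mul_mul_comm, Real.mul_self_sqrt hcard.le, mul_assoc]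

end BilinearForms

/-! ### Rademacher sums -/

section Rademacher

variable {d : ℕ}

/-- The sum `∑ᵢ ± uᵢ`, as a random variable on the cube of all choices of signs. -/
def rademacherSum (u : Fin d → ℝ) (ω : Fin d → ℤˣ) : ℝ := ∑ i, ((ω i : ℤ) : ℝ) * u i

lemma expect_signs_succ (F : (Fin (d + 1) → ℤˣ) → ℝ) :
    𝔼 ω, F ω = 𝔼 ω : Fin d → ℤˣ, (F (Fin.cons 1 ω) + F (Fin.cons (-1) ω)) / 2 := by
  calc 𝔼 ω, F ω = 𝔼 p : ℤˣ × (Fin d → ℤˣ), F (Fin.cons p.1 p.2) :=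
        (Fintype.expect_equiv (Fin.consEquiv fun _ => ℤˣ) _ _ fun _ => rfl).symm
    _ = 𝔼 ω : Fin d → ℤˣ, 𝔼 s : ℤˣ, F (Fin.cons s ω) := by
        rw [← Finset.univ_product_univ, Finset.expect_product, Finset.expect_comm]
    _ = _ := Finset.expect_congr rfl fun ω _ => by
        rw [Fintype.expect_eq_sum_div_card, UnitsInt.univ, Finset.sum_pair (by decide)]
        simp

lemma rademacherSum_cons (u : Fin (d + 1) → ℝ) (s : ℤˣ) (ω : Fin d → ℤˣ) :
    rademacherSum u (Fin.cons s ω) =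
      ((s : ℤ) : ℝ) * u 0 + rademacherSum (fun i => u i.succ) ω := by
  simp [rademacherSum, Fin.sum_univ_succ]

lemma expect_rademacherSum_mul (u v : Fin d → ℝ) :
    𝔼 ω, rademacherSum u ω * rademacherSum v ω = ∑ i, u i * v i := by
  induction d with
  | zero => simp [rademacherSum]
  | succ d ih =>
    calc 𝔼 ω, rademacherSum u ω * rademacherSum v ω
        = 𝔼 ω : Fin d → ℤˣ, (u 0 * v 0 + rademacherSum (fun i => u i.succ) ω *
            rademacherSum (fun i => v i.succ) ω) := by
          rw [expect_signs_succ]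
          refine Finset.expect_congr rfl fun ω _ => ?_
          simp only [rademacherSum_cons]
          push_cast
          ring
      _ = ∑ i, u i * v i := by
          rw [Finset.expect_add_distrib, Fintype.expect_const, ih, Fin.sum_univ_succ]

lemma expect_rademacherSum_pow_four_le (u : Fin d → ℝ) :
    𝔼 ω, rademacherSum u ω ^ 4 ≤ 3 * (∑ i, u i ^ 2) ^ 2 := by
  induction d with
  | zero => simp [rademacherSum]
  | succ d ih =>
    set R := rademacherSum fun i => u i.succ
    have hR : 𝔼 ω, R ω ^ 2 = ∑ i : Fin d, u i.succ ^ 2 := by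
      simpa only [sq] using expect_rademacherSum_mul (fun i => u i.succ) fun i => u i.succ
    calc 𝔼 ω, rademacherSum u ω ^ 4
        = 𝔼 ω, (u 0 ^ 4 + 6 * u 0 ^ 2 * R ω ^ 2 + R ω ^ 4) := by
          rw [expect_signs_succ]
          refine Finset.expect_congr rfl fun ω _ => ?_
          simp only [rademacherSum_cons]
          push_cast
          ring
      _ = u 0 ^ 4 + 6 * u 0 ^ 2 * ∑ i : Fin d, u i.succ ^ 2 + 𝔼 ω, R ω ^ 4 := by
          simp only [Finset.expect_add_distrib, Fintype.expect_const, ← Finset.mul_expect, hR]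
      _ ≤ 3 * (u 0 ^ 2 + ∑ i : Fin d, u i.succ ^ 2) ^ 2 := by
          nlinarith [ih fun i => u i.succ, sq_nonneg (u 0 ^ 2)]
      _ = 3 * (∑ i, u i ^ 2) ^ 2 := by rw [Fin.sum_univ_succ]

end Rademacher

/-! ### Grothendieck's inequality -/

section Grothendieck

open ProbabilityTheory (truncation)

lemma sub_truncation_sq_mul_le {Ω : Type*} (f : Ω → ℝ) {M : ℝ} (hM : 0 ≤ M) (ω : Ω) :
    (f ω - truncation f M ω) ^ 2 * M ^ 2 ≤ f ω ^ 4 := by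
  by_cases hf : |f ω| < M
  · rw [ProbabilityTheory.truncation_eq_self hf, sub_self, zero_pow two_ne_zero, zero_mul]
    positivity
  · have hMf : M ^ 2 ≤ f ω ^ 2 := sq_le_sq.2 (by rwa [abs_of_nonneg hM, ← not_lt])
    have hrem : (f ω - truncation f M ω) ^ 2 ≤ f ω ^ 2 := by
      simp only [truncation, Function.comp_apply, Set.indicator, id]
      split_ifs
      · rw [sub_self, zero_pow two_ne_zero]; positivity
      · rw [sub_zero]
    calc (f ω - truncation f M ω) ^ 2 * M ^ 2 ≤ f ω ^ 2 * f ω ^ 2 := by gcongr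
      _ = f ω ^ 4 := by ring

section Moments

variable {d : ℕ} {u : EuclideanSpace ℝ (Fin d)}

lemma expect_rademacherSum_sq_le_one (hu : ‖u‖ ≤ 1) : 𝔼 ω, rademacherSum u ω ^ 2 ≤ 1 := by
  have hsq := EuclideanSpace.real_norm_sq_eq u
  simp only [sq, expect_rademacherSum_mul] at hsq ⊢
  exact hsq ▸ mul_le_one₀ hu (norm_nonneg u) hu

lemma expect_truncation_rademacherSum_sq_le_one (hu : ‖u‖ ≤ 1) (M : ℝ) :
    𝔼 ω, truncation (rademacherSum u) M ω ^ 2 ≤ 1 :=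
  (Finset.expect_le_expect fun ω _ =>
    sq_le_sq.2 (ProbabilityTheory.abs_truncation_le_abs_self _ M ω)).trans
      (expect_rademacherSum_sq_le_one hu)

lemma expect_rademacherSum_sub_truncation_sq_le (hu : ‖u‖ ≤ 1) {M : ℝ} (hM : 0 < M) :
    𝔼 ω, (rademacherSum u ω - truncation (rademacherSum u) M ω) ^ 2 ≤ 3 / M ^ 2 := by
  rw [le_div_iff₀ (by positivity), Finset.expect_mul]
  calc 𝔼 ω, (rademacherSum u ω - truncation (rademacherSum u) M ω) ^ 2 * M ^ 2
      ≤ 𝔼 ω, rademacherSum u ω ^ 4 :=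
        Finset.expect_le_expect fun ω _ => sub_truncation_sq_mul_le _ hM.le ω
    _ ≤ 3 * (∑ i, u i ^ 2) ^ 2 := expect_rademacherSum_pow_four_le _
    _ ≤ 3 := by
        rw [← EuclideanSpace.real_norm_sq_eq, ← pow_mul]
        linarith [pow_le_one₀ (n := 2 * 2) (norm_nonneg u) hu]

end Moments

variable {I J : Type*} [Fintype I] [Fintype J] {A : Matrix I J ℝ} {c : ℝ}

lemma IsBilinBound.sum_mul_expect_le {Ω : Type*} [Fintype Ω] [Nonempty Ω] (h : IsBilinBound A c)
    {r s : ℝ} (hr : 0 < r) (hs : 0 < s) {f : I → Ω → ℝ} {g : J → Ω → ℝ}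
    (hf : ∀ i ω, |f i ω| ≤ r) (hg : ∀ j ω, |g j ω| ≤ s) :
    ∑ i, ∑ j, A i j * 𝔼 ω, f i ω * g j ω ≤ r * s * c := by
  simp only [Finset.mul_expect, ← Finset.expect_sum_comm]
  exact Finset.expect_le Finset.univ_nonempty fun ω _ =>
    h.sum_mul_le hr hs (fun i => hf i ω) fun j => hg j ω

-- The truncation level `8` makes the remainders so short that they cost only half of `v`.
lemma IsBilinBound.isVectorBilinBound_add_half (h : IsBilinBound A c) {v : ℝ}
    (hv : IsVectorBilinBound A v) : IsVectorBilinBound A (64 * c + v / 2) := by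
  intro d a b ha hb
  let R (x : EuclideanSpace ℝ (Fin d)) := rademacherSum x
  let T (x : EuclideanSpace ℝ (Fin d)) := truncation (R x) 8
  have hsplit (i : I) (j : J) : inner ℝ (a i) (b j) = 𝔼 ω, T (a i) ω * T (b j) ω +
      𝔼 ω, T (a i) ω * (R (b j) ω - T (b j) ω) + 𝔼 ω, (R (a i) ω - T (a i) ω) * R (b j) ω := by
    calc inner ℝ (a i) (b j) = 𝔼 ω, R (a i) ω * R (b j) ω := by
          simp only [R, expect_rademacherSum_mul, PiLp.inner_apply, RCLike.inner_apply,
            conj_trivial, mul_comm]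
      _ = _ := by
          rw [← Finset.expect_add_distrib, ← Finset.expect_add_distrib]
          exact Finset.expect_congr rfl fun ω _ => by ring
  have hT (x : EuclideanSpace ℝ (Fin d)) (ω) : |T x ω| ≤ 8 :=
    (ProbabilityTheory.abs_truncation_le_bound _ _ _).trans_eq (abs_of_pos (by norm_num))
  have hrem {x : EuclideanSpace ℝ (Fin d)} (hx : ‖x‖ ≤ 1) :
      𝔼 ω, (R x ω - T x ω) ^ 2 ≤ (1 / 4) ^ 2 :=
    (expect_rademacherSum_sub_truncation_sq_le hx (by norm_num)).trans (by norm_num)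
  have hTT := h.sum_mul_expect_le (by norm_num) (by norm_num) (fun i => hT (a i)) fun j => hT (b j)
  have hTR := hv.sum_mul_expect_le one_pos (by norm_num)
    (fun i => (expect_truncation_rademacherSum_sq_le_one (ha i) 8).trans_eq (one_pow 2).symm)
    fun j => hrem (hb j)
  have hRR := hv.sum_mul_expect_le (by norm_num) one_pos (fun i => hrem (ha i))
    fun j => (expect_rademacherSum_sq_le_one (hb j)).trans_eq (one_pow 2).symm
  simp only [hsplit, mul_add, Finset.sum_add_distrib]
  linarith

lemma IsBilinBound.isVectorBilinBound (h : IsBilinBound A c) : IsVectorBilinBound A (128 * c) := by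
  let v := sInf {v | IsVectorBilinBound A v}
  have hne : {v | IsVectorBilinBound A v}.Nonempty := ⟨_, isVectorBilinBound_sum_abs A⟩
  have hbdd : BddBelow {v | IsVectorBilinBound A v} := ⟨0, fun _ hv => hv.nonneg⟩
  have hv : IsVectorBilinBound A v := fun d a b ha hb =>
    le_csInf hne fun _ hw => hw d a b ha hb
  have hvc : v ≤ 64 * c + v / 2 := csInf_le hbdd (h.isVectorBilinBound_add_half hv)
  exact fun d a b ha hb => (hv d a b ha hb).trans (by linarith)

lemma isGrothendieckBound_iff {K : ℝ} : IsGrothendieckBound K ↔ ∀ (p q : ℕ)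
    (A : Matrix (Fin p) (Fin q) ℝ) (c : ℝ), IsBilinBound A c → IsVectorBilinBound A (K * c) :=
  Iff.rfl

lemma IsGrothendieckBound.nonneg {K : ℝ} (hK : IsGrothendieckBound K) : 0 ≤ K := by
  have h : IsBilinBound (0 : Matrix (Fin 0) (Fin 0) ℝ) 1 := fun a b _ _ => by simp
  simpa using (isGrothendieckBound_iff.1 hK _ _ _ _ h).nonneg

theorem isGrothendieckBound_grothendieckConstant : IsGrothendieckBound grothendieckConstant := by
  have hne : {K | IsGrothendieckBound K}.Nonempty :=
    ⟨128, isGrothendieckBound_iff.2 fun _ _ _ _ h => h.isVectorBilinBound⟩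
  intro p q A c h d a b ha hb
  have hc : 0 ≤ c := by simpa using h 0 0 (by simp) (by simp)
  obtain rfl | hc := hc.eq_or_lt
  · obtain ⟨K, hK⟩ := hne
    simpa using hK p q A 0 h d a b ha hb
  · rw [← div_le_iff₀ hc]
    exact le_csInf hne fun K hK => (div_le_iff₀ hc).2 (hK p q A c h d a b ha hb)

lemma grothendieckConstant_nonneg : 0 ≤ grothendieckConstant :=
  isGrothendieckBound_grothendieckConstant.nonneg

theorem IsGrothendieckBound.isVectorBilinBound {K : ℝ} (hK : IsGrothendieckBound K)
    (h : IsBilinBound A c) : IsVectorBilinBound A (K * c) := by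
  let e := Fintype.equivFin I
  let e' := Fintype.equivFin J
  have hfin : IsBilinBound (A.submatrix e.symm e'.symm) c := fun a b ha hb => by
    have := h (a ∘ e) (b ∘ e') (fun i => ha _) fun j => hb _
    rw [← e.symm.sum_comp] at this
    simp_rw [← e'.symm.sum_comp] at this
    simpa using this
  intro d a b ha hb
  have := hK _ _ _ c hfin d (a ∘ e.symm) (b ∘ e'.symm) (fun i => ha _) fun j => hb _
  rw [← e.symm.sum_comp]
  simp_rw [← e'.symm.sum_comp]
  exact this

end Grothendieck

/-! ### Hilbert-Schmidt norm, trace norm and operator norm -/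

section HilbertSchmidt

variable {q : Type*} [Fintype q]

/-- A matrix as a vector of the Hilbert-Schmidt space. -/
def hsVec (A : Matrix q q ℂ) : EuclideanSpace ℂ (q × q) := WithLp.toLp 2 A.vec

lemma inner_hsVec (A B : Matrix q q ℂ) :
    inner ℂ (hsVec A) (hsVec B) = (A.conjTranspose * B).trace := by
  rw [← Matrix.star_vec_dotProduct_vec, EuclideanSpace.inner_eq_star_dotProduct, dotProduct_comm]
  rfl

lemma norm_hsVec (A : Matrix q q ℂ) : ‖hsVec A‖ = hsNorm A := by
  rw [@norm_eq_sqrt_re_inner ℂ, inner_hsVec]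
  rfl

lemma hsNorm_conjTranspose (A : Matrix q q ℂ) : hsNorm A.conjTranspose = hsNorm A := by
  rw [hsNorm, hsNorm, Matrix.conjTranspose_conjTranspose, Matrix.trace_mul_comm]

variable {I J : Type*} [Fintype I] [Fintype J] {D : Matrix I J ℝ} {c : ℝ}

lemma IsVectorBilinBound.sum_mul_re_trace_le (h : IsVectorBilinBound D c) {r s : ℝ} (hr : 0 < r)
    (hs : 0 < s) {U : I → Matrix q q ℂ} {V : J → Matrix q q ℂ} (hU : ∀ i, hsNorm (U i) ≤ r)
    (hV : ∀ j, hsNorm (V j) ≤ s) : ∑ i, ∑ j, D i j * (U i * V j).trace.re ≤ r * s * c := by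
  let _ : InnerProductSpace ℝ (EuclideanSpace ℂ (q × q)) := .rclikeToReal ℂ _
  have hinner (i : I) (j : J) :
      inner ℝ (hsVec (U i).conjTranspose) (hsVec (V j)) = (U i * V j).trace.re := by
    rw [real_inner_eq_re_inner ℂ, inner_hsVec, Matrix.conjTranspose_conjTranspose]
    rfl
  simpa only [hinner] using h.sum_mul_inner_le hr hs
    (fun i => (norm_hsVec _).trans_le ((hsNorm_conjTranspose _).trans_le (hU i)))
    (fun j => (norm_hsVec _).trans_le (hV j))

variable [DecidableEq q]

lemma hsNorm_mul_le (W A : Matrix q q ℂ) : hsNorm (W * A) ≤ ‖W‖ * hsNorm A := by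
  have hle : star A * (star W * W) * A ≤ ‖star W * W‖ • (star A * A) :=
    CStarAlgebra.star_left_conjugate_le_norm_smul
  have htrace := (Complex.nonneg_iff.1 (Matrix.le_iff.1 hle).trace_nonneg).1
  rw [Matrix.trace_sub, Complex.sub_re, sub_nonneg, Matrix.trace_smul, CStarRing.norm_star_mul_self,
    Complex.smul_re, smul_eq_mul] at htrace
  calc hsNorm (W * A) ≤ √(‖W‖ * ‖W‖ * (A.conjTranspose * A).trace.re) := Real.sqrt_le_sqrt <| by
        simpa only [Matrix.star_eq_conjTranspose, Matrix.conjTranspose_mul, mul_assoc] using htrace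
    _ = ‖W‖ * hsNorm A := by
        rw [Real.sqrt_mul (by positivity), Real.sqrt_mul_self (norm_nonneg _), hsNorm]

lemma hsNorm_sqrt {σ : Matrix q q ℂ} (hσ : σ.PosSemidef) :
    hsNorm (CFC.sqrt σ) = √σ.trace.re := by
  have hsa : (CFC.sqrt σ).conjTranspose = CFC.sqrt σ :=
    (IsSelfAdjoint.of_nonneg (CFC.sqrt_nonneg σ)).star_eq
  rw [hsNorm, hsa, CFC.sqrt_mul_sqrt_self σ (Matrix.nonneg_iff_posSemidef.2 hσ)]

end HilbertSchmidt

section Polar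

variable {ι : Type*} [Fintype ι] [DecidableEq ι]

/-- The adjoint `(A* A)^(-1/2) A*` of the partial isometry in the polar decomposition of `A`. The
functional calculus takes the pseudo-inverse of the square root, since `0⁻¹ = 0`. -/
def polarAdjoint (A : Matrix ι ι ℂ) : Matrix ι ι ℂ :=
  cfc (fun t : ℝ => (√t)⁻¹) (A.conjTranspose * A) * A.conjTranspose

lemma norm_polarAdjoint_le_one (A : Matrix ι ι ℂ) : ‖polarAdjoint A‖ ≤ 1 := by
  let H := A.conjTranspose * A
  let g (t : ℝ) := (√t)⁻¹
  have hH : 0 ≤ H := star_mul_self_nonneg A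
  have hcont (g : ℝ → ℝ) : ContinuousOn g (spectrum ℝ H) :=
    Matrix.finite_real_spectrum.continuousOn g
  have hg : star (cfc g H) = cfc g H := (cfc_predicate g H : IsSelfAdjoint _).star_eq
  have hW : polarAdjoint A * star (polarAdjoint A) = cfc (fun t => g t * t * g t) H := by
    have hsa : IsSelfAdjoint H := .of_nonneg hH
    calc polarAdjoint A * star (polarAdjoint A) = cfc g H * H * cfc g H := by
          rw [polarAdjoint, star_mul, hg, Matrix.star_eq_conjTranspose,
            Matrix.conjTranspose_conjTranspose]
          simp only [H, g, mul_assoc]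
      _ = cfc (fun t => g t * t * g t) H := by
          rw [cfc_mul (fun t => g t * t) g H (hcont _) (hcont _),
            cfc_mul g (fun t => t) H (hcont _) (hcont _), cfc_id' ℝ H]
  have hnorm : ‖cfc (fun t => g t * t * g t) H‖ ≤ 1 := by
    refine norm_cfc_le zero_le_one fun t ht => ?_
    have ht0 : 0 ≤ t := spectrum_nonneg_of_nonneg hH ht
    have hsq : g t * t * g t = (√t * (√t)⁻¹) ^ 2 := by
      rw [mul_pow, Real.sq_sqrt ht0]
      ring
    rw [hsq, Real.norm_of_nonneg (sq_nonneg _)]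
    exact pow_le_one₀ (by positivity) mul_inv_le_one
  rw [← hW, CStarRing.norm_self_mul_star, ← sq] at hnorm
  exact (sq_le_one_iff₀ (norm_nonneg _)).1 hnorm

lemma polarAdjoint_mul_self (A : Matrix ι ι ℂ) :
    polarAdjoint A * A = CFC.sqrt (A.conjTranspose * A) := by
  let H := A.conjTranspose * A
  have hH : 0 ≤ H := star_mul_self_nonneg A
  have hsa : IsSelfAdjoint H := .of_nonneg hH
  have hcont (g : ℝ → ℝ) : ContinuousOn g (spectrum ℝ H) :=
    Matrix.finite_real_spectrum.continuousOn g
  calc polarAdjoint A * A = cfc (fun t : ℝ => (√t)⁻¹) H * H := mul_assoc _ _ _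
    _ = cfc (fun t : ℝ => (√t)⁻¹ * t) H := by
        rw [cfc_mul (fun t : ℝ => (√t)⁻¹) (fun t => t) H (hcont _) (hcont _), cfc_id' ℝ H]
    _ = cfc Real.sqrt H := cfc_congr fun t _ => by
        rw [inv_mul_eq_div, Real.div_sqrt]
    _ = CFC.sqrt H := by
        rw [CFC.sqrt_eq_real_sqrt H hH, cfcₙ_eq_cfc (hf := Real.continuous_sqrt.continuousOn)]

lemma traceNorm_eq_re_trace_polarAdjoint_mul (A : Matrix ι ι ℂ) :
    traceNorm A = (polarAdjoint A * A).trace.re := by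
  rw [polarAdjoint_mul_self, traceNorm]

end Polar

section BlockDiagonal

variable {ι q : Type*} [Fintype ι] [DecidableEq ι] [Fintype q]

lemma trace_mul_blockDiagonal (W : Matrix (q × ι) (q × ι) ℂ) (Z : ι → Matrix q q ℂ) :
    (W * Matrix.blockDiagonal Z).trace = ∑ y, (W.blockDiag y * Z y).trace := by
  simp only [Matrix.trace, Matrix.diag_apply, Matrix.mul_apply, Fintype.sum_prod_type,
    Matrix.blockDiagonal_apply, Matrix.blockDiag_apply, mul_ite, mul_zero, Finset.sum_ite_eq',
    Finset.mem_univ, if_true]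
  exact Finset.sum_comm

variable [DecidableEq q]

lemma norm_blockDiag_le (W : Matrix (q × ι) (q × ι) ℂ) (y : ι) : ‖W.blockDiag y‖ ≤ ‖W‖ := by
  let E : Matrix (q × ι) q ℂ := (1 : Matrix (q × ι) (q × ι) ℂ).submatrix id fun i => (i, y)
  have hEE : E.conjTranspose * E = 1 := by
    ext i j
    simp [E, Matrix.mul_apply, Matrix.one_apply]
  have hE : ‖E‖ ≤ 1 := by
    have hone : ‖(1 : Matrix q q ℂ)‖ ≤ 1 := by
      rcases subsingleton_or_nontrivial (Matrix q q ℂ)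
      · simp [Subsingleton.elim (1 : Matrix q q ℂ) 0]
      · exact CStarRing.norm_one.le
    rw [← hEE, Matrix.l2_opNorm_conjTranspose_mul_self, ← sq] at hone
    exact (sq_le_one_iff₀ (norm_nonneg _)).1 hone
  have hW : W.blockDiag y = E.conjTranspose * W * E := by
    ext i j
    simp [E, Matrix.blockDiag_apply, Matrix.mul_apply, Matrix.one_apply]
  calc ‖W.blockDiag y‖ ≤ ‖E.conjTranspose * W‖ * ‖E‖ := hW ▸ Matrix.l2_opNorm_mul _ _
    _ ≤ ‖E.conjTranspose‖ * ‖W‖ * ‖E‖ := by gcongr; exact Matrix.l2_opNorm_mul _ _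
    _ ≤ 1 * ‖W‖ * 1 := by rw [Matrix.l2_opNorm_conjTranspose]; gcongr
    _ = ‖W‖ := by ring

-- Tested against a contraction `W` on the output, the trace norm is a combination of the
-- Hilbert-Schmidt inner products of `W y * A` and `C x * B`.
theorem IsVectorBilinBound.traceNorm_blockDiagonal_le {X Y : Type*} [Fintype X] [Fintype Y]
    [DecidableEq Y] {D : Matrix Y X ℝ} {c : ℝ} (h : IsVectorBilinBound D c) {A B : Matrix q q ℂ}
    (hA : hsNorm A ≤ 1) (hB : hsNorm B ≤ 1) {C : X → Matrix q q ℂ} {r : ℝ} (hr : 0 < r)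
    (hC : ∀ x, ‖C x‖ ≤ r) :
    traceNorm (Matrix.blockDiagonal fun y => A * (∑ x, (D y x : ℂ) • C x) * B) ≤ r * c := by
  let Z (y : Y) := A * (∑ x, (D y x : ℂ) • C x) * B
  let W := polarAdjoint (Matrix.blockDiagonal Z)
  have hU (y : Y) : hsNorm (W.blockDiag y * A) ≤ 1 := (hsNorm_mul_le _ _).trans <|
    mul_le_one₀ ((norm_blockDiag_le W y).trans (norm_polarAdjoint_le_one _)) (Real.sqrt_nonneg _) hA
  have hV (x : X) : hsNorm (C x * B) ≤ r := (hsNorm_mul_le _ _).trans <|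
    (mul_le_mul (hC x) hB (Real.sqrt_nonneg _) hr.le).trans_eq (mul_one r)
  calc traceNorm (Matrix.blockDiagonal Z) = ∑ y, (W.blockDiag y * Z y).trace.re := by
        rw [traceNorm_eq_re_trace_polarAdjoint_mul, trace_mul_blockDiagonal, Complex.re_sum]
    _ = ∑ y, ∑ x, D y x * (W.blockDiag y * A * (C x * B)).trace.re := by
        simp only [Z, Finset.mul_sum, Finset.sum_mul, Matrix.trace_sum, Complex.re_sum,
          Matrix.smul_mul, Matrix.mul_smul, Matrix.trace_smul, smul_eq_mul,
          Complex.re_ofReal_mul, mul_assoc]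
    _ ≤ 1 * r * c := h.sum_mul_re_trace_le one_pos hr hU hV
    _ = r * c := by rw [one_mul]

end BlockDiagonal

/-! ### Bounded and completely bounded norms -/

section BoundedNorm

variable {X Y : Type*} [Fintype X] [Fintype Y] {D : Matrix Y X ℝ}

lemma isBilinBound_of_boundedNorm_le (𝕜 : Type*) [RCLike 𝕜] [Nonempty X] {K : ℝ} {ε : ℝ≥0}
    (hK : K ≤ Fintype.card X)
    (h : boundedNorm (capNorm K) l1Norm (D.map (algebraMap ℝ 𝕜)).mulVecLin ≤ ε) :
    IsBilinBound D (Fintype.card X * ε) := by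
  refine isBilinBound_of_sum_abs_mulVec_le fun b hb => ?_
  have hN : (0 : ℝ) < Fintype.card X := by exact_mod_cast Fintype.card_pos
  let P (x : X) : 𝕜 := algebraMap ℝ 𝕜 ((Fintype.card X : ℝ)⁻¹ * b x)
  have hP (x : X) : ‖P x‖ ≤ (Fintype.card X : ℝ)⁻¹ := by
    rw [norm_algebraMap', norm_mul, Real.norm_of_nonneg (inv_pos.2 hN).le]
    exact mul_le_of_le_one_right (inv_pos.2 hN).le (hb x)
  have hcap : capNorm K P ≤ 1 := by
    rw [capNorm, ENNReal.ofReal_le_one, max_le_iff]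
    constructor
    · calc K * ‖P‖ ≤ Fintype.card X * (Fintype.card X : ℝ)⁻¹ :=
            mul_le_mul hK ((pi_norm_le_iff_of_nonneg (inv_pos.2 hN).le).2 hP) (norm_nonneg _) hN.le
        _ = 1 := mul_inv_cancel₀ hN.ne'
    · calc ∑ x, ‖P x‖ ≤ Fintype.card X • (Fintype.card X : ℝ)⁻¹ :=
            Finset.sum_le_card_nsmul _ _ _ fun x _ => hP x
        _ = 1 := by rw [nsmul_eq_mul, mul_inv_cancel₀ hN.ne']
  have hnorm (y : Y) : ‖((D.map (algebraMap ℝ 𝕜)).mulVec P) y‖ =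
      (Fintype.card X : ℝ)⁻¹ * |D.mulVec b y| := by
    have hcoe : (D.map (algebraMap ℝ 𝕜)).mulVec P y =
        algebraMap ℝ 𝕜 ((Fintype.card X : ℝ)⁻¹ * D.mulVec b y) := by
      simp only [P, Matrix.mulVec, dotProduct, Matrix.map_apply, Finset.mul_sum, map_sum, map_mul]
      exact Finset.sum_congr rfl fun x _ => mul_left_comm _ _ _
    rw [hcoe, norm_algebraMap', norm_mul, Real.norm_of_nonneg (inv_pos.2 hN).le, Real.norm_eq_abs]
  have hle := (le_iSup₂ (f := fun (P : X → 𝕜) (_ : capNorm K P ≤ 1) =>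
    l1Norm ((D.map (algebraMap ℝ 𝕜)).mulVec P)) P hcap).trans h
  rw [l1Norm, ENNReal.ofReal_le_coe] at hle
  simpa only [hnorm, ← Finset.mul_sum, inv_mul_le_iff₀ hN] using hle

lemma ofReal_mul_norm_le_capCapMatrixNorm {ι q : Type*} [Fintype ι] [DecidableEq ι] [Fintype q]
    [DecidableEq q] {K : ℝ} (hK : 0 ≤ K) (x : Matrix (q × ι) (q × ι) ℂ) :
    ENNReal.ofReal (K * ‖x‖) ≤ capCapMatrixNorm K x := by
  refine le_iInf fun a => le_iInf fun b => le_iInf fun hx => ENNReal.ofReal_le_ofReal ?_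
  calc K * ‖x‖ ≤ K * (‖a‖ * ‖b‖) := by
        rw [hx, ← Matrix.l2_opNorm_conjTranspose b]
        exact mul_le_mul_of_nonneg_left (Matrix.l2_opNorm_mul _ _) hK
    _ = (√K * ‖a‖) * (√K * ‖b‖) := by rw [mul_mul_mul_comm, Real.mul_self_sqrt hK]
    _ ≤ _ := by gcongr <;> exact le_max_left _ _

variable [DecidableEq X] [DecidableEq Y]

-- Only the operator norm part of `∩·∩{K ℓ_∞, ℓ₁}` enters.
theorem IsVectorBilinBound.cbNorm_mulVecLin_le {c K : ℝ} (h : IsVectorBilinBound D c)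
    (hK : 0 < K) :
    cbNorm (capCapNorm K) l1MatrixNorm (D.map (algebraMap ℝ ℂ)).mulVecLin ≤
      ENNReal.ofReal (K⁻¹ * c) := by
  refine iSup_le fun Q => iSup₂_le fun x hx => iSup₂_le fun A B => iSup₂_le fun hA hB =>
    ENNReal.ofReal_le_ofReal ?_
  have hnorm : ‖diagEmbed x‖ ≤ K⁻¹ := by
    rw [← mul_one K⁻¹, le_inv_mul_iff₀ hK, ← ENNReal.ofReal_le_one]
    exact (ofReal_mul_norm_le_capCapMatrixNorm hK.le _).trans hx
  have hblock (k : X) : x.map (· k) = (diagEmbed x).blockDiag k :=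
    (congrFun (Matrix.blockDiag_blockDiagonal fun k => x.map (· k)) k).symm
  have hC (k : X) : ‖x.map (· k)‖ ≤ K⁻¹ := by
    rw [hblock]
    exact (norm_blockDiag_le _ _).trans hnorm
  have hmap (y : Y) : (x.map (D.map (algebraMap ℝ ℂ)).mulVecLin).map (· y) =
      ∑ k, (D y k : ℂ) • x.map (· k) := by
    ext i j
    simp [Matrix.mulVec, dotProduct, Matrix.sum_apply]
  refine le_of_eq_of_le ?_ (h.traceNorm_blockDiagonal_le hA hB (inv_pos.2 hK) hC)
  simp only [Matrix.kronecker_one, diagEmbed, ← Matrix.blockDiagonal_mul, hmap]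

end BoundedNorm

/-! ### Extractors -/

section Extractor

variable {X Y S : Type*} [Fintype X] [Fintype Y] [Fintype S] [DecidableEq Y] {f : S → X → Y}
  {k ε : ℝ}

/-- The real matrix of the map `extMap 𝕜 f`. -/
def extMatrix (f : S → X → Y) : Matrix Y X ℝ :=
  (Fintype.card S : ℝ)⁻¹ • ∑ s, funMatrix ℝ (f s) - Matrix.of fun y _ => uniform ℝ Y y

lemma extMap_eq_mulVecLin (𝕜 : Type*) [RCLike 𝕜] (f : S → X → Y) :
    extMap 𝕜 f = ((extMatrix f).map (algebraMap ℝ 𝕜)).mulVecLin := by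
  have hmap : (extMatrix f).map (algebraMap ℝ 𝕜) =
      (Fintype.card S : 𝕜)⁻¹ • ∑ s, funMatrix 𝕜 (f s) - Matrix.of fun y _ => uniform 𝕜 Y y := by
    ext y x
    simp [extMatrix, funMatrix, uniform, Matrix.sum_apply]
  ext x y
  simp [hmap, extMap, Matrix.mulVec, dotProduct, mul_comm]

lemma extMatrix_mulVec (f : S → X → Y) (P : X → ℝ) : (extMatrix f).mulVec P =
    (Fintype.card S : ℝ)⁻¹ • ∑ s, (funMatrix ℝ (f s)).mulVec P - (∑ x, P x) • uniform ℝ Y := by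
  ext y
  have h := congrFun (LinearMap.congr_fun (extMap_eq_mulVecLin ℝ f) P) y
  simpa [extMap, ← Finset.sum_mul] using h.symm

lemma IsExtractor.sum_abs_mulVec_le (h : IsExtractor f k ε) {p : X → ℝ} (hp0 : ∀ x, 0 ≤ p x)
    (hp1 : ∀ x, p x ≤ 1) (hs : (2 : ℝ) ^ k ≤ ∑ x, p x) :
    ∑ y, |(extMatrix f).mulVec p y| ≤ (∑ x, p x) * ε := by
  set s := ∑ x, p x
  have h2k : (0 : ℝ) < 2 ^ k := Real.rpow_pos_of_pos two_pos k
  have hs0 : 0 < s := h2k.trans_le hs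
  have hsum : ∑ x, (s⁻¹ • p) x = 1 := by
    simp only [Pi.smul_apply, smul_eq_mul, ← Finset.mul_sum]
    exact inv_mul_cancel₀ hs0.ne'
  have hmem : s⁻¹ • p ∈ stdSimplex ℝ X :=
    ⟨fun x => mul_nonneg (inv_pos.2 hs0).le (hp0 x), hsum⟩
  have hnorm : ‖s⁻¹ • p‖ ≤ (2 : ℝ) ^ (-k) := by
    have hp : ‖p‖ ≤ 1 := (pi_norm_le_iff_of_nonneg zero_le_one).2 fun x =>
      (Real.norm_of_nonneg (hp0 x)).trans_le (hp1 x)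
    rw [norm_smul, Real.norm_of_nonneg (inv_pos.2 hs0).le, Real.rpow_neg two_pos.le]
    exact (mul_le_of_le_one_right (inv_pos.2 hs0).le hp).trans (inv_anti₀ h2k hs)
  have hpos : 0 < ‖s⁻¹ • p‖ := norm_pos_iff.2 fun h0 => by
    rw [h0] at hsum
    simp at hsum
  have hent : k ≤ minEntropy (s⁻¹ • p) := by
    rwa [minEntropy, le_neg, Real.logb_le_iff_le_rpow one_lt_two hpos]
  have hout (y : Y) : ((Fintype.card S : ℝ)⁻¹ • ∑ s', (funMatrix ℝ (f s')).mulVec (s⁻¹ • p)) y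
      - uniform ℝ Y y = s⁻¹ * (extMatrix f).mulVec p y := by
    have hP := congrFun (extMatrix_mulVec f (s⁻¹ • p)) y
    rw [hsum, one_smul, Matrix.mulVec_smul] at hP
    exact hP.symm
  have hle := h _ hmem hent
  simp only [hout, abs_mul, abs_of_pos (inv_pos.2 hs0), ← Finset.mul_sum] at hle
  rwa [inv_mul_le_iff₀ hs0] at hle

lemma IsExtractor.nonneg [Nonempty X] (h : IsExtractor f k ε)
    (hk : (2 : ℝ) ^ k ≤ Fintype.card X) : 0 ≤ ε := by
  have hle := h.sum_abs_mulVec_le (p := 1) (fun _ => zero_le_one) (fun _ => le_rfl) (by simpa)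
  refine nonneg_of_mul_nonneg_right ((Finset.sum_nonneg fun _ _ => abs_nonneg _).trans hle) ?_
  simp [Fintype.card_pos]

-- Up to the sign of `b`, the weight `(1 + b) / 2` has mass at least `|X| / 2`.
theorem IsExtractor.isBilinBound [Nonempty X] (h : IsExtractor f k ε)
    (hk : 2 * (2 : ℝ) ^ k ≤ Fintype.card X) :
    IsBilinBound (extMatrix f) (3 * (Fintype.card X * ε)) := by
  refine isBilinBound_of_sum_abs_mulVec_le fun b hb => ?_
  wlog hb0 : 0 ≤ ∑ x, b x generalizing b
  · have := this (-b) (by simpa using hb) (by simp; linarith)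
    simpa [Matrix.mulVec_neg] using this
  have h2k : (0 : ℝ) < 2 ^ k := Real.rpow_pos_of_pos two_pos k
  have hε : 0 ≤ ε := h.nonneg (by linarith)
  have hmass {p : X → ℝ} (hp0 : ∀ x, 0 ≤ p x) (hp1 : ∀ x, p x ≤ 1) (hs : (2 : ℝ) ^ k ≤ ∑ x, p x) :
      ∑ y, |(extMatrix f).mulVec p y| ≤ Fintype.card X * ε := by
    refine (h.sum_abs_mulVec_le hp0 hp1 hs).trans (mul_le_mul_of_nonneg_right ?_ hε)
    exact (Finset.sum_le_card_nsmul _ _ 1 fun x _ => hp1 x).trans_eq (by simp)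
  let p (x : X) := (1 + b x) / 2
  have hsum : ∑ x, p x = (Fintype.card X + ∑ x, b x) / 2 := by
    simp [p, ← Finset.sum_div, Finset.sum_add_distrib]
  have hp : ∑ y, |(extMatrix f).mulVec p y| ≤ Fintype.card X * ε :=
    hmass (fun x => by linarith [(abs_le.1 (hb x)).1, show p x = (1 + b x) / 2 from rfl])
      (fun x => by linarith [(abs_le.1 (hb x)).2, show p x = (1 + b x) / 2 from rfl])
      (by linarith)
  have hone : ∑ y, |(extMatrix f).mulVec 1 y| ≤ Fintype.card X * ε :=
    hmass (fun _ => zero_le_one) (fun _ => le_rfl) (by simp; linarith)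
  have hb_eq : b = (2 : ℝ) • p - 1 := by
    ext x
    simp [p]
    ring
  calc ∑ y, |(extMatrix f).mulVec b y|
      ≤ ∑ y, (2 * |(extMatrix f).mulVec p y| + |(extMatrix f).mulVec 1 y|) := by
        refine Finset.sum_le_sum fun y _ => ?_
        rw [hb_eq, Matrix.mulVec_sub, Matrix.mulVec_smul, Pi.sub_apply, Pi.smul_apply, smul_eq_mul]
        exact (abs_sub _ _).trans_eq (by rw [abs_mul, abs_two])
    _ = 2 * ∑ y, |(extMatrix f).mulVec p y| + ∑ y, |(extMatrix f).mulVec 1 y| := by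
        rw [Finset.sum_add_distrib, Finset.mul_sum]
    _ ≤ 3 * (Fintype.card X * ε) := by linarith

end Extractor

/-! ### Min-entropy and quantum side information -/

lemma nonempty_of_trace_eq_one {n : Type*} [Fintype n] {A : Matrix n n ℂ} (h : A.trace = 1) :
    Nonempty n := by
  by_contra hn
  rw [not_nonempty_iff] at hn
  simp [Matrix.trace] at h

section MinEntropy

open Filter Topology

variable {X q : Type*} [DecidableEq X] [Fintype q]

/-- The values of `t` over which the infimum in the definition of `condMinEntropy ρ` is taken. -/
def minEntropyBounds (ρ : Matrix (q × X) (q × X) ℂ) : Set ℝ :=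
  {t : ℝ | ∃ σ : Matrix q q ℂ, σ.PosSemidef ∧ σ.trace = 1 ∧
    (((t : ℂ) • (σ ⊗ₖ (1 : Matrix X X ℂ))) - ρ).PosSemidef}

lemma inv_card_le_of_mem_minEntropyBounds [Fintype X] [Nonempty X] {ρ : Matrix (q × X) (q × X) ℂ}
    (hρ : ρ.trace = 1) {t : ℝ} (ht : t ∈ minEntropyBounds ρ) : (Fintype.card X : ℝ)⁻¹ ≤ t := by
  obtain ⟨σ, -, hσ, h⟩ := ht
  have htrace := h.trace_nonneg
  rw [Matrix.trace_sub, Matrix.trace_smul, Matrix.trace_kronecker, hσ, hρ, Matrix.trace_one,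
    smul_eq_mul, one_mul, sub_nonneg] at htrace
  have htrace' : 1 ≤ t * Fintype.card X := by exact_mod_cast htrace
  exact (inv_le_iff_one_le_mul₀ (by exact_mod_cast Fintype.card_pos)).2 htrace'

lemma minEntropyBounds_nonempty [Finite X] [Nonempty q] {ρ : Matrix (q × X) (q × X) ℂ}
    (hρ : ρ.IsHermitian) : (minEntropyBounds ρ).Nonempty := by
  classical
  have := Fintype.ofFinite X
  have hq : (Fintype.card q : ℂ) ≠ 0 := by exact_mod_cast Fintype.card_ne_zero
  refine ⟨Fintype.card q * ‖ρ‖, (Fintype.card q : ℂ)⁻¹ • 1,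
    Matrix.PosSemidef.one.smul (by positivity), by simp [hq], ?_⟩
  have hscalar : ((Fintype.card q * ‖ρ‖ : ℝ) : ℂ) • (((Fintype.card q : ℂ)⁻¹ • (1 : Matrix q q ℂ))
      ⊗ₖ (1 : Matrix X X ℂ)) = algebraMap ℝ (Matrix (q × X) (q × X) ℂ) ‖ρ‖ := by
    ext i j
    simp [Matrix.smul_kronecker, Algebra.algebraMap_eq_smul_one, Matrix.smul_apply]
    field_simp
  rw [hscalar, ← Matrix.le_iff]
  exact IsSelfAdjoint.le_algebraMap_norm_self hρ

lemma exists_posDef_of_mem_minEntropyBounds [Nonempty q] {ρ : X → Matrix q q ℂ} {t₁ t : ℝ}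
    (ht₁ : t₁ ∈ minEntropyBounds (Matrix.blockDiagonal ρ)) (h₁ : 0 < t₁) (h : t₁ < t) :
    ∃ σ : Matrix q q ℂ, σ.PosDef ∧ σ.trace = 1 ∧ ∀ x, ((t : ℂ) • σ - ρ x).PosSemidef := by
  classical
  obtain ⟨σ, hσ, htr, hle⟩ := ht₁
  have hblock (x : X) : ((t₁ : ℂ) • σ - ρ x).PosSemidef := by
    convert hle.submatrix fun i : q => (i, x) using 1
    ext i j
    simp [Matrix.blockDiagonal_apply]
  have ht₁C : (0 : ℂ) ≤ t₁ := by exact_mod_cast h₁.le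
  have htC : (0 : ℂ) < t := by exact_mod_cast h₁.trans h
  have hsub : (0 : ℂ) < t - t₁ := by exact_mod_cast sub_pos.2 h
  have hcard : (0 : ℂ) < Fintype.card q := by exact_mod_cast Fintype.card_pos
  let τ : Matrix q q ℂ := (Fintype.card q : ℂ)⁻¹ • 1
  have hτ : τ.PosDef := Matrix.PosDef.one.smul (inv_pos.2 hcard)
  have hτtr : τ.trace = 1 := by simp [τ, hcard.ne']
  refine ⟨(t : ℂ)⁻¹ • ((t₁ : ℂ) • σ + ((t : ℂ) - t₁) • τ),
    (Matrix.PosDef.posSemidef_add (hσ.smul ht₁C) (hτ.smul hsub)).smul (inv_pos.2 htC), ?_,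
    fun x => ?_⟩
  · rw [Matrix.trace_smul, Matrix.trace_add, Matrix.trace_smul, Matrix.trace_smul, htr, hτtr]
    simp [htC.ne']
  · rw [smul_inv_smul₀ htC.ne', add_sub_right_comm]
    exact (hblock x).add (hτ.smul hsub).posSemidef

variable [Fintype X]

lemma inv_card_le_sInf_minEntropyBounds {ρ : Matrix (q × X) (q × X) ℂ}
    (hρ : ρ.IsHermitian) (htr : ρ.trace = 1) :
    (Fintype.card X : ℝ)⁻¹ ≤ sInf (minEntropyBounds ρ) := by
  obtain ⟨_, _⟩ := nonempty_prod.1 (nonempty_of_trace_eq_one htr)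
  exact le_csInf (minEntropyBounds_nonempty hρ) fun _ => inv_card_le_of_mem_minEntropyBounds htr

lemma sInf_minEntropyBounds_le_of_le_condMinEntropy {ρ : Matrix (q × X) (q × X) ℂ}
    (hρ : ρ.IsHermitian) (htr : ρ.trace = 1) {k : ℝ} (hk : k ≤ condMinEntropy ρ) :
    sInf (minEntropyBounds ρ) ≤ 2 ^ (-k) := by
  have := (nonempty_prod.1 (nonempty_of_trace_eq_one htr)).2
  have hpos : 0 < sInf (minEntropyBounds ρ) :=
    (inv_pos.2 (by exact_mod_cast Fintype.card_pos)).trans_le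
      (inv_card_le_sInf_minEntropyBounds hρ htr)
  rw [← Real.logb_le_iff_le_rpow one_lt_two hpos]
  exact le_neg.1 hk

lemma rpow_le_card_of_le_condMinEntropy {ρ : Matrix (q × X) (q × X) ℂ}
    (hρ : ρ.IsHermitian) (htr : ρ.trace = 1) {k : ℝ} (hk : k ≤ condMinEntropy ρ) :
    (2 : ℝ) ^ k ≤ Fintype.card X := by
  have := (nonempty_prod.1 (nonempty_of_trace_eq_one htr)).2
  have hle := (inv_card_le_sInf_minEntropyBounds hρ htr).trans
    (sInf_minEntropyBounds_le_of_le_condMinEntropy hρ htr hk)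
  rwa [Real.rpow_neg two_pos.le, inv_le_inv₀ (by exact_mod_cast Fintype.card_pos)
    (Real.rpow_pos_of_pos two_pos k)] at hle

lemma exists_posDef_of_le_condMinEntropy {ρ : X → Matrix q q ℂ}
    (hρ : ∀ x, (ρ x).IsHermitian) (htr : ∑ x, (ρ x).trace = 1) {k t : ℝ}
    (hk : k ≤ condMinEntropy (Matrix.blockDiagonal ρ)) (ht : (2 : ℝ) ^ (-k) < t) :
    ∃ σ : Matrix q q ℂ, σ.PosDef ∧ σ.trace = 1 ∧ ∀ x, ((t : ℂ) • σ - ρ x).PosSemidef := by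
  have hherm := Matrix.isHermitian_blockDiagonal_iff.2 hρ
  have htrace : (Matrix.blockDiagonal ρ).trace = 1 := by rw [Matrix.trace_blockDiagonal, htr]
  obtain ⟨_, _⟩ := nonempty_prod.1 (nonempty_of_trace_eq_one htrace)
  obtain ⟨t₁, ht₁, hlt⟩ := exists_lt_of_csInf_lt (minEntropyBounds_nonempty hherm)
    ((sInf_minEntropyBounds_le_of_le_condMinEntropy hherm htrace hk).trans_lt ht)
  exact exists_posDef_of_mem_minEntropyBounds ht₁
    ((inv_pos.2 (by exact_mod_cast Fintype.card_pos)).trans_le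
      (inv_card_le_of_mem_minEntropyBounds htrace ht₁)) hlt

variable [DecidableEq q]

lemma exists_sqrt_mul_mul_sqrt {σ : Matrix q q ℂ} (hσ : σ.PosDef) {t : ℝ} (ht : 0 ≤ t)
    {ρ : Matrix q q ℂ} (hρ : ρ.PosSemidef) (h : ((t : ℂ) • σ - ρ).PosSemidef) :
    ∃ C : Matrix q q ℂ, ‖C‖ ≤ t ∧ ρ = CFC.sqrt σ * C * CFC.sqrt σ := by
  have hσ0 : 0 ≤ σ := hσ.posSemidef.nonneg
  let s := CFC.sqrt σ
  have hss : s * s = σ := CFC.sqrt_mul_sqrt_self σ hσ0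
  have hdet : IsUnit s.det :=
    (Matrix.isUnit_iff_isUnit_det s).1 ((CFC.isUnit_sqrt_iff σ hσ0).2 hσ.isUnit)
  have hinv : s * s⁻¹ = 1 := Matrix.mul_nonsing_inv s hdet
  have hinv' : s⁻¹ * s = 1 := Matrix.nonsing_inv_mul s hdet
  have hsa : s⁻¹.conjTranspose = s⁻¹ := by
    rw [Matrix.conjTranspose_nonsing_inv, ← Matrix.star_eq_conjTranspose,
      (IsSelfAdjoint.of_nonneg (CFC.sqrt_nonneg σ)).star_eq]
  have hσ1 : s⁻¹ * σ * s⁻¹ = 1 := by rw [← hss, ← mul_assoc, hinv', one_mul, hinv]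
  have hC : (s⁻¹ * ρ * s⁻¹).PosSemidef := by
    simpa only [hsa] using hρ.conjTranspose_mul_mul_same s⁻¹
  have hCt : ((t : ℂ) • (1 : Matrix q q ℂ) - s⁻¹ * ρ * s⁻¹).PosSemidef := by
    simpa only [hsa, mul_sub, sub_mul, Matrix.mul_smul, Matrix.smul_mul, hσ1] using
      h.conjTranspose_mul_mul_same s⁻¹
  refine ⟨s⁻¹ * ρ * s⁻¹, ?_, ?_⟩
  · rw [CStarAlgebra.norm_le_iff_le_algebraMap _ ht hC.nonneg, Matrix.le_iff,
      Algebra.algebraMap_eq_smul_one]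
    exact hCt
  · calc ρ = (s * s⁻¹) * ρ * (s⁻¹ * s) := by rw [hinv, hinv', one_mul, mul_one]
      _ = s * (s⁻¹ * ρ * s⁻¹) * s := by simp only [mul_assoc]

-- Write `ρ x = √σ * C x * √σ` with `‖C x‖ ≤ t` for `t` slightly above `2 ^ (-k)`; then `√σ` is a
-- Hilbert-Schmidt unit vector.
theorem IsVectorBilinBound.traceNorm_blockDiagonal_le_of_le_condMinEntropy {Y : Type*} [Fintype Y]
    [DecidableEq Y] {D : Matrix Y X ℝ} {c : ℝ} (h : IsVectorBilinBound D c) {ρ : X → Matrix q q ℂ}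
    (hρ : ∀ x, (ρ x).PosSemidef) (htr : ∑ x, (ρ x).trace = 1) {k : ℝ}
    (hk : k ≤ condMinEntropy (Matrix.blockDiagonal ρ)) :
    traceNorm (Matrix.blockDiagonal fun y => ∑ x, (D y x : ℂ) • ρ x) ≤ 2 ^ (-k) * c := by
  have hlim : Tendsto (fun t : ℝ => t * c) (𝓝[>] (2 ^ (-k))) (𝓝 (2 ^ (-k) * c)) :=
    ((continuous_mul_const c).tendsto _).mono_left nhdsWithin_le_nhds
  refine ge_of_tendsto hlim (eventually_mem_nhdsWithin.mono fun t ht => ?_)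
  have ht0 : 0 < t := (Real.rpow_pos_of_pos two_pos _).trans ht
  obtain ⟨σ, hσ, hσtr, hle⟩ :=
    exists_posDef_of_le_condMinEntropy (fun x => (hρ x).isHermitian) htr hk ht
  choose C hC hCρ using fun x => exists_sqrt_mul_mul_sqrt hσ ht0.le (hρ x) (hle x)
  have hs : hsNorm (CFC.sqrt σ) ≤ 1 := by simp [hsNorm_sqrt hσ.posSemidef, hσtr]
  have hout (y : Y) : ∑ x, (D y x : ℂ) • ρ x =
      CFC.sqrt σ * (∑ x, (D y x : ℂ) • C x) * CFC.sqrt σ := by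
    simp only [Finset.mul_sum, Finset.sum_mul, Matrix.mul_smul, Matrix.smul_mul, ← hCρ]
  simpa only [hout] using h.traceNorm_blockDiagonal_le hs hs ht0 hC

end MinEntropy

section QuantumOutput

variable {X Y S q : Type*} [Fintype X] [Fintype Y] [Fintype S] [DecidableEq Y]

lemma quantum_output_eq_blockDiagonal (f : S → X → Y) (ρ : X → Matrix q q ℂ) :
    (Fintype.card S : ℂ)⁻¹ •
        ∑ s, Matrix.blockDiagonal (fun y => ∑ x, funMatrix ℂ (f s) y x • ρ x)
      - (∑ x, ρ x) ⊗ₖ Matrix.diagonal (uniform ℂ Y) =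
    Matrix.blockDiagonal fun y => ∑ x, (extMatrix f y x : ℂ) • ρ x := by
  have hkron : (∑ x, ρ x) ⊗ₖ Matrix.diagonal (uniform ℂ Y) =
      Matrix.blockDiagonal fun y => uniform ℂ Y y • ∑ x, ρ x := by
    rw [Matrix.kronecker_diagonal]
    simp only [op_smul_eq_smul]
  have hcoe (y : Y) (x : X) : (extMatrix f y x : ℂ) =
      (Fintype.card S : ℂ)⁻¹ * ∑ s, funMatrix ℂ (f s) y x - uniform ℂ Y y := by
    simp [extMatrix, funMatrix, uniform, Matrix.sum_apply]
  ext ⟨i, y⟩ ⟨j, y'⟩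
  simp only [hkron, hcoe, Matrix.sub_apply, Matrix.smul_apply, Matrix.sum_apply,
    Matrix.blockDiagonal_apply, smul_eq_mul]
  split_ifs with hy
  · simp only [sub_mul, Finset.sum_sub_distrib, Finset.sum_mul, Finset.mul_sum]
    rw [Finset.sum_comm]
    simp only [mul_assoc]
  · simp

end QuantumOutput

theorem IsExtractor.isQuantumProofExtractor {X Y S : Type*} [Fintype X] [DecidableEq X] [Fintype Y]
    [DecidableEq Y] [Fintype S] {f : S → X → Y} {k ε C : ℝ} (h : IsExtractor f k ε)
    (hC : 3 / 2 * grothendieckConstant * (Fintype.card X / 2 ^ k) ≤ C) :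
    IsQuantumProofExtractor f (k + 1) (C * ε) := by
  intro Q ρ hρ htr hk
  have hherm := Matrix.isHermitian_blockDiagonal_iff.2 fun x => (hρ x).isHermitian
  have htrace : (Matrix.blockDiagonal ρ).trace = 1 := by rw [Matrix.trace_blockDiagonal, htr]
  obtain ⟨_, _⟩ := nonempty_prod.1 (nonempty_of_trace_eq_one htrace)
  have h2k : (0 : ℝ) < 2 ^ k := Real.rpow_pos_of_pos two_pos k
  have hcard : 2 * (2 : ℝ) ^ k ≤ Fintype.card X := by
    simpa only [Real.rpow_add two_pos, Real.rpow_one, mul_comm] using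
      rpow_le_card_of_le_condMinEntropy hherm htrace hk
  have hε : 0 ≤ ε := h.nonneg (by linarith)
  have hvec := isGrothendieckBound_grothendieckConstant.isVectorBilinBound (h.isBilinBound hcard)
  rw [quantum_output_eq_blockDiagonal]
  calc traceNorm (Matrix.blockDiagonal fun y => ∑ x, (extMatrix f y x : ℂ) • ρ x)
      ≤ 2 ^ (-(k + 1)) * (grothendieckConstant * (3 * (Fintype.card X * ε))) :=
        hvec.traceNorm_blockDiagonal_le_of_le_condMinEntropy hρ htr hk
    _ = 3 / 2 * grothendieckConstant * (Fintype.card X / 2 ^ k) * ε := by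
        rw [Real.rpow_neg two_pos.le, Real.rpow_add two_pos, Real.rpow_one]
        field_simp
    _ ≤ C * ε := mul_le_mul_of_nonneg_right hC hε

theorem cbNorm_extMap_le {𝕜 X Y S : Type*} [RCLike 𝕜] [Fintype X] [DecidableEq X] [Fintype Y]
    [DecidableEq Y] [Fintype S] [Nonempty X] {f : S → X → Y} {K : ℝ} {ε : ℝ≥0} (hK : 0 < K)
    (hKX : K ≤ Fintype.card X) (h : boundedNorm (capNorm K) l1Norm (extMap 𝕜 f) ≤ ε) :
    cbNorm (capCapNorm K) l1MatrixNorm (extMap ℂ f) ≤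
      ENNReal.ofReal (grothendieckConstant * (Fintype.card X / K)) * ε := by
  rw [extMap_eq_mulVecLin] at h
  have hvec := isGrothendieckBound_grothendieckConstant.isVectorBilinBound
    (isBilinBound_of_boundedNorm_le 𝕜 hKX h)
  rw [extMap_eq_mulVecLin]
  refine (hvec.cbNorm_mulVecLin_le hK).trans_eq ?_
  have := grothendieckConstant_nonneg
  rw [← ENNReal.ofReal_coe_nnreal, ← ENNReal.ofReal_mul (by positivity)]
  congr 1
  ring

end QExt

end

theorem theorem4_general {S X Y : Type*} [Fintype S] [Nonempty S] [Fintype X] [DecidableEq X]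
    [Nonempty X] [Fintype Y] [Nonempty Y] [DecidableEq Y] (f : S → X → Y) (k ε : ℝ) {C : ℝ}
    (hC : 3 / 2 ≤ C) :
    (k ≤ Real.logb 2 (Fintype.card X) →
      (QExt.boundedNorm (QExt.capNorm ((2 : ℝ) ^ k)) QExt.l1Norm (QExt.extMap ℝ f)
          ≤ ENNReal.ofReal ε ∨
        QExt.boundedNorm (QExt.capNorm ((2 : ℝ) ^ k)) QExt.l1Norm (QExt.extMap ℂ f)
          ≤ ENNReal.ofReal ε) →
      QExt.cbNorm (QExt.capCapNorm ((2 : ℝ) ^ k)) QExt.l1MatrixNorm (QExt.extMap ℂ f)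
        ≤ ENNReal.ofReal
          (QExt.grothendieckConstant * (2 : ℝ) ^ (Real.logb 2 (Fintype.card X) - k) * ε)) ∧
    (QExt.IsExtractor f k ε →
      QExt.IsQuantumProofExtractor f (k + 1)
        (C * QExt.grothendieckConstant * (2 : ℝ) ^ (Real.logb 2 (Fintype.card X) - k) * ε)) ∧
    (0 < Real.logb 2 (Fintype.card X) →
      Real.logb 2 (Fintype.card X) - Real.logb 2 (Real.logb 2 (Fintype.card X)) ≤ k →
      QExt.IsExtractor f k ε → QExt.IsQuantumProofExtractor f (k + 1)
        (C * QExt.grothendieckConstant * Real.logb 2 (Fintype.card X) * ε)) := by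
  set N := Real.logb 2 (Fintype.card X) with hN
  have hcard : (0 : ℝ) < Fintype.card X := by exact_mod_cast Fintype.card_pos
  have h2k : (0 : ℝ) < 2 ^ k := Real.rpow_pos_of_pos two_pos k
  have hdiv : (2 : ℝ) ^ (N - k) = Fintype.card X / 2 ^ k := by
    rw [Real.rpow_sub two_pos, hN, Real.rpow_logb two_pos (by norm_num) hcard]
  have hK := QExt.grothendieckConstant_nonneg
  refine ⟨fun hk h => ?_, fun h => h.isQuantumProofExtractor ?_,
    fun hN0 hk h => h.isQuantumProofExtractor ?_⟩
  · rw [hdiv, ENNReal.ofReal_mul (by positivity)]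
    have hkX := (Real.le_logb_iff_rpow_le one_lt_two hcard).1 hk
    exact h.elim (QExt.cbNorm_extMap_le h2k hkX) (QExt.cbNorm_extMap_le h2k hkX)
  · rw [hdiv]
    gcongr
  · rw [← hdiv]
    gcongr
    rw [← Real.le_logb_iff_rpow_le one_lt_two hN0]
    exact sub_le_comm.1 hk

theorem theorem4 {S Y : Type*} [Fintype S] [Nonempty S] [Fintype Y] [Nonempty Y] [DecidableEq Y]
    (n : ℕ) (f : S → (Fin n → Bool) → Y) (k ε : ℝ) :
    -- the bound on the completely bounded norm, from real or from complex input vectors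
    (k ≤ n →
      (QExt.boundedNorm (QExt.capNorm ((2 : ℝ) ^ k)) QExt.l1Norm (QExt.extMap ℝ f)
          ≤ ENNReal.ofReal ε ∨
        QExt.boundedNorm (QExt.capNorm ((2 : ℝ) ^ k)) QExt.l1Norm (QExt.extMap ℂ f)
          ≤ ENNReal.ofReal ε) →
      QExt.cbNorm (QExt.capCapNorm ((2 : ℝ) ^ k)) QExt.l1MatrixNorm (QExt.extMap ℂ f)
        ≤ ENNReal.ofReal (QExt.grothendieckConstant * (2 : ℝ) ^ ((n : ℝ) - k) * ε)) ∧
    -- every extractor is quantum-proof with modified parameters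
    (QExt.IsExtractor f k ε →
      QExt.IsQuantumProofExtractor f (k + 1)
        (6 * QExt.grothendieckConstant * (2 : ℝ) ^ ((n : ℝ) - k) * ε)) ∧
    -- the case of very high min-entropy
    (1 ≤ n → (n : ℝ) - Real.logb 2 n ≤ k → QExt.IsExtractor f k ε →
      QExt.IsQuantumProofExtractor f (k + 1) (6 * QExt.grothendieckConstant * n * ε)) := by
  have hcard : Real.logb 2 (Fintype.card (Fin n → Bool)) = n := by simp [Real.logb_pow]
  simpa only [hcard, Nat.cast_pos, Order.one_le_iff_pos] using
    theorem4_general f k ε (C := 6) (by norm_num)
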